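/- Let $\mathbf M=\langle M;F,\le\rangle$, where $\langle M;\le\rangle$ is a finite partially ordered set that is not an antichain and $F$ is a set of unary operations on $M$, each of which is order-preserving or order-reversing. Structures $\mathbf X=\langle X;F,\le\rangle$ of the same signature consist of a (possibly empty) set $X$ with a unary operation for each $f\in F$ and a binary relation $\le$; homomorphisms commute with the operations and preserve $\le$, and embeddings are injective homomorphisms that also reflect $\le$. Powers of $\mathbf M$ (including the power with empty exponent) are structured coordinatewise. Let $\mathcal X=\mathsf{IS}^0\mathsf P(\mathbf M)$ be the class of isomorphic copies of (possibly empty) substructures of powers of $\mathbf M$. Let $\mathbf M_{\mathscr T}$ be $\mathbf M$ with the discrete topology, and let $\mathcal X_{\mathscr T}=\mathsf{IS}^0_{\mathrm c}\mathsf P(\mathbf M_{\mathscr T})$ be the class of isomorphic (algebraically, relationally and topologically) copies of (possibly empty) topologically closed substructures of powers of $\mathbf M_{\mathscr T}$ with the product topology. Assume that there is a set $\Sigma$ of atomic formulas (that is, formulas $s=t$ or $s\le t$, with $s,t$ terms in the operations $F$) such that a structure with topology $\mathbf X=\langle X;F,\le,\mathscr T\rangle$ belongs to $\mathcal X_{\mathscr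 T}$ if and only if (i) $\langle X;\le,\mathscr T\rangle$ is a Priestley space; (ii) for all $f\in F$, if $f$ is order-preserving (respectively, order-reversing) on $\mathbf M$, then $f$ is continuous and order-preserving (respectively, order-reversing) on $\mathbf X$; (iii) $\mathbf X$ satisfies (the universal closure of) $\sigma$, for all $\sigma\in\Sigma$. Let $\mathcal X^{\mathrm{ct}}$ be the class of compact Hausdorff structures with topology whose operations are continuous, whose relation $\le$ is closed, and whose topology-free reduct lies in $\mathcal X$; let $\mathcal X^{\mathrm{Bt}}$ consist of those members of $\mathcal X^{\mathrm{ct}}$ whose topology has a basis of clopen sets. For $\mathbf X\in\mathcal X$, the Bohr compactification $b(\mathbf X)$ (respectively, the zero-dimensional Bohr compactification $b_0(\mathbf X)$) is the member $\mathbf B$ of $\mathcal X^{\mathrm{ct}}$ (respectively, $\mathcal X^{\mathrm{Bt}}$), unique up to isomorphism, with an embedding of structures $\iota\colon\mathbf X\to\mathbf B$ with dense image such that every homomorphism $g$ from $\mathbf X$ to the reduct of a member $\mathbf Z$ of $\mathcal X^{\mathrm{ct}}$ (respectively, $\mathcal X^{\mathrm{Bt}}$) is $h\circ\iota$ for a unique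 continuous homomorphism $h\colon\mathbf B\to\mathbf Z$. The natural extension $n_{\mathcal X}(\mathbf X)$ is the topologically closed substructure of $\mathbf M_{\mathscr T}^{\mathcal X(\mathbf X,\mathbf M)}$ generated by the image of the evaluation map $e\colon\mathbf X\to\mathbf M_{\mathscr T}^{\mathcal X(\mathbf X,\mathbf M)}$, $e(a)(x)=x(a)$, where $\mathcal X(\mathbf X,\mathbf M)$ is the set of homomorphisms from $\mathbf X$ to $\mathbf M$. Then $b(\mathbf X)=b_0(\mathbf X)=n_{\mathcal X}(\mathbf X)$ for all $\mathbf X\in\mathcal X$; that is, $n_{\mathcal X}(\mathbf X)$ together with the evaluation map $e$ is both the Bohr compactification and the zero-dimensional Bohr compactification of $\mathbf X$. -/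

import Mathlib

/-!
# Ordered unary structures, their prevarieties, natural extensions and Bohr compactifications

All structures have the signature consisting of a type `F` of unary operation symbols and one
binary relation symbol `≤`. There are no partial operations, so all structures are total.
-/

universe u v

/-- A structure `⟨X; F, ≤⟩`: a set (possibly empty) with a unary operation for each `f : F` and
an arbitrary binary relation `≤`. -/
structure OStr (F : Type v) where
  /-- the underlying set -/
  carrier : Type u
  /-- the operations -/
  op : F → carrier → carrier
  /-- the relation, not assumed to be an order -/
  le : carrier → carrier → Prop

/-- A structure with topology `⟨X; F, ≤, 𝒯⟩`; no compatibility is assumed. The projection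
`TStr.toOStr` forgets the topology. -/
structure TStr (F : Type v) extends OStr.{u, v} F where
  /-- the topology -/
  top : TopologicalSpace carrier

instance TStr.instTopologicalSpace {F : Type v} (X : TStr.{u, v} F) :
    TopologicalSpace X.carrier := X.top

namespace OStr

variable {F : Type v}

/-- A homomorphism: a map that commutes with the operations and preserves the relation. -/
def IsHom (A B : OStr.{u, v} F) (h : A.carrier → B.carrier) : Prop :=
  (∀ f a, h (A.op f a) = B.op f (h a)) ∧ ∀ a a', A.le a a' → B.le (h a) (h a')

/-- An embedding of structures: an injective map that commutes with the operations and both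
preserves and reflects the relation. -/
def IsEmb (A B : OStr.{u, v} F) (h : A.carrier → B.carrier) : Prop :=
  Function.Injective h ∧ (∀ f a, h (A.op f a) = B.op f (h a)) ∧
    ∀ a a', A.le a a' ↔ B.le (h a) (h a')

/-- The hom-set of homomorphisms from `A` to `B`. -/
abbrev Hom (A B : OStr.{u, v} F) : Type u :=
  {h : A.carrier → B.carrier // IsHom A B h}

/-- The set `S` is the universe of a (possibly empty) substructure of `A`. -/
def IsSub (A : OStr.{u, v} F) (S : Set A.carrier) : Prop :=
  ∀ f, ∀ a ∈ S, A.op f a ∈ S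

/-- The substructure of `A` with universe `S`. -/
abbrev restrict (A : OStr.{u, v} F) (S : Set A.carrier) (hS : A.IsSub S) : OStr.{u, v} F where
  carrier := S
  op f a := ⟨A.op f a.1, hS f a.1 a.2⟩
  le a b := A.le a.1 b.1

/-- The power `M ^ I`, structured coordinatewise. -/
abbrev pow (M : OStr.{u, v} F) (I : Type u) : OStr.{u, v} F where
  carrier := I → M.carrier
  op f x := fun i => M.op f (x i)
  le x y := ∀ i, M.le (x i) (y i)

/-- `A` belongs to the prevariety `IS⁰P(M)`: it is isomorphic to a (possibly empty) substructure
of a power `M ^ I` (possibly with `I` empty). -/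
def InISP (M A : OStr.{u, v} F) : Prop :=
  ∃ (I : Type u) (S : Set (M.pow I).carrier) (hS : (M.pow I).IsSub S)
    (h : A.carrier → ((M.pow I).restrict S hS).carrier),
      Function.Surjective h ∧ IsEmb A ((M.pow I).restrict S hS) h

/-- The structure `⟨M; F, ≤⟩` given by an ordered set `M` and self-maps `φ f` of `M`. -/
abbrev ofOrder {M : Type u} [PartialOrder M] (φ : F → M → M) : OStr.{u, v} F where
  carrier := M
  op := φ
  le a b := a ≤ b

/-- `M` with the discrete topology. -/
abbrev discrete (M : OStr.{u, v} F) : TStr.{u, v} F where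
  toOStr := M
  top := ⊥

end OStr

namespace TStr

variable {F : Type v}

/-- The substructure of `A` with universe `S`, with the subspace topology. -/
abbrev restrict (A : TStr.{u, v} F) (S : Set A.carrier) (hS : A.toOStr.IsSub S) :
    TStr.{u, v} F where
  toOStr := A.toOStr.restrict S hS
  top := (inferInstance : TopologicalSpace S)

/-- The power `M ^ I`, structured coordinatewise, with the product topology. -/
abbrev pow (M : TStr.{u, v} F) (I : Type u) : TStr.{u, v} F where
  toOStr := M.toOStr.pow I
  top := (inferInstance : TopologicalSpace (I → M.carrier))

/-- `X` belongs to the topological prevariety `IS⁰_cP(M)`: it is isomorphic, as a structure with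
topology, to a (possibly empty) topologically closed substructure of a power of `M`. -/
def InIScP (M X : TStr.{u, v} F) : Prop :=
  ∃ (I : Type u) (S : Set (M.pow I).carrier) (hS : (M.pow I).toOStr.IsSub S)
    (h : X.carrier → ((M.pow I).restrict S hS).carrier),
      IsClosed S ∧ IsHomeomorph h ∧ OStr.IsEmb X.toOStr ((M.pow I).restrict S hS).toOStr h

/-- The topology of `X` is compatible with the structure, that is, `X` is a topological
structure: the operations are continuous and the relation is closed. -/
def Compatible (X : TStr.{u, v} F) : Prop :=
  (∀ f, Continuous (X.op f)) ∧ IsClosed {p : X.carrier × X.carrier | X.le p.1 p.2}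

/-- The class `𝒜^ct` of compact Hausdorff topological structures with reduct in `𝒜`. -/
def InCt (𝒜 : OStr.{u, v} F → Prop) (X : TStr.{u, v} F) : Prop :=
  CompactSpace X.carrier ∧ T2Space X.carrier ∧ X.Compatible ∧ 𝒜 X.toOStr

/-- The class `𝒜^Bt` of Boolean (compact Hausdorff zero-dimensional) topological structures with
reduct in `𝒜`. -/
def InBt (𝒜 : OStr.{u, v} F → Prop) (X : TStr.{u, v} F) : Prop :=
  X.InCt 𝒜 ∧ TopologicalSpace.IsTopologicalBasis {U : Set X.carrier | IsClopen U}

/-- `B` with the map `i : A → B` is a compactification of `A` universal for the class `𝒞` of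
structures with topology: `B` is in `𝒞`, the map `i` is an embedding of structures with dense
image, and each homomorphism from `A` into (the reduct of) a member of `𝒞` factors through `i` by
a unique continuous homomorphism. -/
def IsUniversalCompactification (𝒞 : TStr.{u, v} F → Prop) (A : OStr.{u, v} F)
    (B : TStr.{u, v} F) (i : A.carrier → B.carrier) : Prop :=
  𝒞 B ∧ OStr.IsEmb A B.toOStr i ∧ Dense (Set.range i) ∧
    ∀ Z : TStr.{u, v} F, 𝒞 Z → ∀ g : A.carrier → Z.carrier, OStr.IsHom A Z.toOStr g →
      ∃! h : B.carrier → Z.carrier,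
        Continuous h ∧ OStr.IsHom B.toOStr Z.toOStr h ∧ h ∘ i = g

/-- `(B, i)` is the Bohr compactification `b(A)` of `A`, relative to the class `𝒜`. -/
def IsBohr (𝒜 : OStr.{u, v} F → Prop) (A : OStr.{u, v} F)
    (B : TStr.{u, v} F) (i : A.carrier → B.carrier) : Prop :=
  IsUniversalCompactification (InCt 𝒜) A B i

/-- `(B, i)` is the zero-dimensional Bohr compactification `b₀(A)` of `A`, relative to `𝒜`. -/
def IsZeroDimBohr (𝒜 : OStr.{u, v} F → Prop) (A : OStr.{u, v} F)
    (B : TStr.{u, v} F) (i : A.carrier → B.carrier) : Prop :=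
  IsUniversalCompactification (InBt 𝒜) A B i

/-- The universe of the topologically closed substructure of `Y` generated by the set `E`. -/
def closedSpan (Y : TStr.{u, v} F) (E : Set Y.carrier) : Set Y.carrier :=
  ⋂₀ {S | IsClosed S ∧ Y.toOStr.IsSub S ∧ E ⊆ S}

theorem closedSpan_isSub (Y : TStr.{u, v} F) (E : Set Y.carrier) :
    Y.toOStr.IsSub (Y.closedSpan E) :=
  fun f a ha S hS => hS.2.1 f a (ha S hS)

theorem subset_closedSpan (Y : TStr.{u, v} F) (E : Set Y.carrier) : E ⊆ Y.closedSpan E :=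
  fun _ ha _ hS => hS.2.2 ha

/-- The evaluation map from `A` to the power of `M` indexed by the hom-set from `A` to `M`. -/
abbrev eval (M : TStr.{u, v} F) (A : OStr.{u, v} F) (a : A.carrier) :
    (M.pow (OStr.Hom A M.toOStr)).carrier :=
  fun x => x.1 a

/-- The natural extension of `A` relative to `M`: the closed substructure generated by the image
of the evaluation map. -/
abbrev natExt (M : TStr.{u, v} F) (A : OStr.{u, v} F) : TStr.{u, v} F :=
  (M.pow (OStr.Hom A M.toOStr)).restrict
    ((M.pow (OStr.Hom A M.toOStr)).closedSpan (Set.range (eval M A))) (closedSpan_isSub _ _)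

/-- The evaluation map from `A` into its natural extension. -/
def natEmb (M : TStr.{u, v} F) (A : OStr.{u, v} F) (a : A.carrier) : (natExt M A).carrier :=
  ⟨eval M A a, subset_closedSpan _ _ ⟨a, rfl⟩⟩

/-- `⟨X; ≤, 𝒯⟩` is a Priestley space: the relation is a partial order, the space is compact, and
points are separated by clopen up-sets (as expressed by `PriestleySpace`). -/
def IsPriestley (X : TStr.{u, v} F) : Prop :=
  ∃ o : PartialOrder X.carrier,
    (∀ x y, o.le x y ↔ X.le x y) ∧ CompactSpace X.carrier ∧ PriestleySpace X.carrier

end TStr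

/-- Terms in the variables `x₀, x₁, …`. -/
inductive OTerm (F : Type v) : Type v
  | var (n : ℕ) : OTerm F
  | app (f : F) (t : OTerm F) : OTerm F

/-- Atomic formulas: `s = t` and `s ≤ t`, for terms `s` and `t`. -/
inductive OAtom (F : Type v) : Type v
  | eq (s t : OTerm F) : OAtom F
  | le (s t : OTerm F) : OAtom F

/-- The value of a term at an assignment of the variables. -/
def OTerm.val {F : Type v} (X : OStr.{u, v} F) (w : ℕ → X.carrier) : OTerm F → X.carrier
  | .var n => w n
  | .app f t => X.op f (OTerm.val X w t)

/-- `X` satisfies the atomic formula, that is, it holds at every assignment. -/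
def OStr.Satisfies {F : Type v} (X : OStr.{u, v} F) : OAtom F → Prop
  | .eq s t => ∀ w : ℕ → X.carrier, s.val X w = t.val X w
  | .le s t => ∀ w : ℕ → X.carrier, X.le (s.val X w) (t.val X w)

open Topology

section Structures

variable {F : Type v}

/-! ### Terms under homomorphisms and limits -/

namespace OTerm

/-! The crux is an intermediate compactification `ultraStr` of X that is universal for reasons of
order alone. Take the ultrafilters on X, preordered by the up-sets they contain, and pass to the
quotient poset. Up-sets of X give clopen up-sets separating points, so this is a Priestley space.
Operations that preserve or reverse order extend to it continuously, and atomic formulas true in X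
survive because X is dense and the order is closed (`ultraStr_satisfies`). The assumed
axiomatization therefore puts `ultraStr` in the topological prevariety of M.

Two extension properties then meet. Homomorphisms from X into members of that prevariety extend to
the natural extension (`exists_extension_natExt`), so the natural extension maps onto a dense part
of `ultraStr`. Homomorphisms from X into any compact Hausdorff Z with closed order extend to
`ultraStr` by limits along ultrafilters (`exists_extension_ultraStr`); Z need not be Priestley,
since `extend_mono` uses only that its order is closed. Composing extends every homomorphism X → Z
to the natural extension. Uniqueness is density, and as the natural extension is itself Boolean,
both Bohr compactifications are obtained at once. -/

theorem val_map {A B : OStr.{u, v} F} {h : A.carrier → B.carrier}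
    (hh : ∀ f a, h (A.op f a) = B.op f (h a)) (w : ℕ → A.carrier) (t : OTerm F) :
    h (t.val A w) = t.val B (h ∘ w) := by
  induction t with
  | var n => rfl
  | app f t ih => simp only [OTerm.val, hh, ih]

theorem continuous_val (X : TStr.{u, v} F) (hX : ∀ f, Continuous (X.op f)) (t : OTerm F) :
    Continuous fun w : ℕ → X.carrier => t.val X.toOStr w := by
  induction t with
  | var n => exact continuous_apply n
  | app f t ih => exact (hX f).comp ih

end OTerm

namespace OStr

theorem IsHom.comp {A B C : OStr.{u, v} F} {k : B.carrier → C.carrier} {h : A.carrier → B.carrier}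
    (hk : IsHom B C k) (hh : IsHom A B h) : IsHom A C (k ∘ h) :=
  ⟨fun f a => by simp only [Function.comp, hh.1, hk.1], fun a a' l => hk.2 _ _ (hh.2 _ _ l)⟩

theorem IsEmb.satisfies {A B : OStr.{u, v} F} {h : A.carrier → B.carrier} (hh : IsEmb A B h)
    {σ : OAtom F} (hB : B.Satisfies σ) : A.Satisfies σ := by
  cases σ with
  | eq s t =>
    intro w
    apply hh.1
    rw [OTerm.val_map hh.2.1, OTerm.val_map hh.2.1]
    exact hB _
  | le s t =>
    intro w
    rw [hh.2.2, OTerm.val_map hh.2.1, OTerm.val_map hh.2.1]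
    exact hB _

/-- Members of a prevariety embed into a power. -/
theorem InISP.exists_isEmb {M A : OStr.{u, v} F} (hA : InISP M A) :
    ∃ (I : Type u) (h : A.carrier → I → M.carrier), IsEmb A (M.pow I) h := by
  obtain ⟨I, S, hS, h, -, hinj, hop, hle⟩ := hA
  exact ⟨I, fun a => (h a).1, Subtype.val_injective.comp hinj,
    fun f a => congrArg Subtype.val (hop f a), hle⟩

/-! ### The Priestley order-compactification by ultrafilters -/

/-- A set closed upwards under the relation of the structure. -/
def IsUp (X : OStr.{u, v} F) (A : Set X.carrier) : Prop :=
  ∀ a b, X.le a b → a ∈ A → b ∈ A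

/-- The preorder on ultrafilters: every up-set that is large for the first is large for the
second. -/
abbrev ultraPreorder (X : OStr.{u, v} F) : Preorder (Ultrafilter X.carrier) where
  le U V := ∀ A, X.IsUp A → A ∈ U → A ∈ V
  le_refl _ _ _ h := h
  le_trans _ _ _ h h' A hA hU := h' A hA (h A hA hU)

/-- Ultrafilters that contain the same up-sets are identified. -/
abbrev ultraSetoid (X : OStr.{u, v} F) : Setoid (Ultrafilter X.carrier) :=
  letI := X.ultraPreorder
  AntisymmRel.setoid _ (· ≤ ·)

/-- The largest Priestley order-compactification of the relational reduct. -/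
abbrev UltraQuot (X : OStr.{u, v} F) : Type u := Quotient X.ultraSetoid

/-- Every operation either preserves or reverses the relation. -/
def OpsMonotoneOrAntitone (X : OStr.{u, v} F) : Prop :=
  ∀ f, (∀ x y, X.le x y → X.le (X.op f x) (X.op f y)) ∨
    (∀ x y, X.le x y → X.le (X.op f y) (X.op f x))

theorem ultra_map_mono (X : OStr.{u, v} F) {k : X.carrier → X.carrier}
    (hk : ∀ x y, X.le x y → X.le (k x) (k y)) {U V : Ultrafilter X.carrier}
    (h : X.ultraPreorder.le U V) : X.ultraPreorder.le (U.map k) (V.map k) :=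
  fun A hA hU => h (k ⁻¹' A) (fun a b l => hA _ _ (hk a b l)) hU

/-- The preimage of an up-set under an order-reversing map is a down-set, so its complement is an
up-set; an ultrafilter contains exactly one of the two. -/
theorem ultra_map_anti (X : OStr.{u, v} F) {k : X.carrier → X.carrier}
    (hk : ∀ x y, X.le x y → X.le (k y) (k x)) {U V : Ultrafilter X.carrier}
    (h : X.ultraPreorder.le U V) : X.ultraPreorder.le (V.map k) (U.map k) := by
  intro A hA hV
  by_contra hU
  have hU' : (k ⁻¹' A)ᶜ ∈ U := Ultrafilter.compl_mem_iff_notMem.2 hU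
  have := h (k ⁻¹' A)ᶜ (fun a b l ha hb => ha (hA _ _ (hk a b l) hb)) hU'
  exact Ultrafilter.compl_mem_iff_notMem.1 this hV

theorem ultra_map_equiv (X : OStr.{u, v} F) (hX : X.OpsMonotoneOrAntitone) (f : F)
    {U V : Ultrafilter X.carrier} (h : X.ultraSetoid U V) :
    X.ultraSetoid (U.map (X.op f)) (V.map (X.op f)) := by
  rcases hX f with hk | hk
  · exact ⟨X.ultra_map_mono hk h.1, X.ultra_map_mono hk h.2⟩
  · exact ⟨X.ultra_map_anti hk h.2, X.ultra_map_anti hk h.1⟩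

/-- The order on the quotient of the space of ultrafilters. -/
def ultraLe (X : OStr.{u, v} F) : X.UltraQuot → X.UltraQuot → Prop :=
  Quotient.lift₂ X.ultraPreorder.le fun _ _ _ _ h h' => propext
    ⟨fun l A hA m => h'.1 A hA (l A hA (h.2 A hA m)),
      fun l A hA m => h'.2 A hA (l A hA (h.1 A hA m))⟩

/-- The Priestley order-compactification, with the operations extended continuously. -/
def ultraStr (X : OStr.{u, v} F) (hX : X.OpsMonotoneOrAntitone) : TStr.{u, v} F where
  carrier := X.UltraQuot
  op f := Quotient.map (Ultrafilter.map (X.op f)) fun _ _ h => X.ultra_map_equiv hX f h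
  le := X.ultraLe
  top := inferInstance

/-- The principal ultrafilter map. -/
def toUltra (X : OStr.{u, v} F) (hX : X.OpsMonotoneOrAntitone) (a : X.carrier) :
    (X.ultraStr hX).carrier :=
  Quotient.mk X.ultraSetoid (pure a)

variable (X : OStr.{u, v} F) (hX : X.OpsMonotoneOrAntitone)

theorem isHom_toUltra : IsHom X (X.ultraStr hX).toOStr (X.toUltra hX) :=
  ⟨fun f a => congrArg (Quotient.mk X.ultraSetoid)
      (Ultrafilter.coe_injective (by simp : (_ : Filter _) = _)),
    fun a b l A hA (ha : a ∈ A) => (hA a b l ha : b ∈ A)⟩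

theorem denseRange_toUltra : DenseRange (X.toUltra hX) :=
  (Quotient.mk_surjective (s := X.ultraSetoid)).denseRange.comp denseRange_pure
    continuous_quotient_mk'

theorem continuous_ultrafilter_map {α : Type u} (k : α → α) :
    Continuous (Ultrafilter.map k) := by
  refine ultrafilterBasis_is_basis.continuous_iff.2 ?_
  rintro _ ⟨A, rfl⟩
  exact ultrafilter_isOpen_basic (k ⁻¹' A)

theorem continuous_ultraStr_op (f : F) : Continuous ((X.ultraStr hX).op f) :=
  (continuous_ultrafilter_map (X.op f)).quotient_map'
    fun _ _ h => X.ultra_map_equiv hX f h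

/-- Equivalent ultrafilters contain the same up-sets, so a basic clopen set given by an up-set is
saturated and descends to the quotient. -/
theorem isClopen_ultra {A : Set X.carrier} (hA : X.IsUp A) :
    ∃ K : Set (X.ultraStr hX).carrier, IsClopen K ∧
      ∀ U : Ultrafilter X.carrier, Quotient.mk X.ultraSetoid U ∈ K ↔ A ∈ U := by
  refine ⟨Quotient.lift (fun U : Ultrafilter X.carrier => A ∈ U)
    fun U V h => propext ⟨h.1 A hA, h.2 A hA⟩, ⟨?_, ?_⟩, fun U => Iff.rfl⟩
  · exact isQuotientMap_quotient_mk'.isClosed_preimage.1 (ultrafilter_isClosed_basic A)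
  · exact isQuotientMap_quotient_mk'.isOpen_preimage.1 (ultrafilter_isOpen_basic A)

/-- A failure of the order is by definition witnessed by an up-set of X. This one separation yields
both the Priestley axiom and the closedness of the order. -/
theorem exists_isClopen_of_not_ultraLe {p q : (X.ultraStr hX).carrier}
    (h : ¬ (X.ultraStr hX).le p q) :
    ∃ K : Set (X.ultraStr hX).carrier, IsClopen K ∧
      (∀ x y, (X.ultraStr hX).le x y → x ∈ K → y ∈ K) ∧ p ∈ K ∧ q ∉ K := by
  obtain ⟨U, rfl⟩ := Quotient.exists_rep p
  obtain ⟨V, rfl⟩ := Quotient.exists_rep q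
  have h' : ¬ ∀ A, X.IsUp A → A ∈ U → A ∈ V := h
  push Not at h'
  obtain ⟨A, hA, hU, hV⟩ := h'
  obtain ⟨K, hK, hm⟩ := X.isClopen_ultra hX hA
  refine ⟨K, hK, fun x y => ?_, (hm U).2 hU, fun hv => hV ((hm V).1 hv)⟩
  obtain ⟨U, rfl⟩ := Quotient.exists_rep x
  obtain ⟨V, rfl⟩ := Quotient.exists_rep y
  exact fun l hx => (hm V).2 (l A hA ((hm U).1 hx))

theorem isPriestley_ultraStr : (X.ultraStr hX).IsPriestley := by
  let o : PartialOrder (X.ultraStr hX).carrier :=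
    { le := X.ultraLe
      le_refl := by
        intro p
        obtain ⟨U, rfl⟩ := Quotient.exists_rep p
        exact fun _ _ h => h
      le_trans := by
        intro p q r
        obtain ⟨U, rfl⟩ := Quotient.exists_rep p
        obtain ⟨V, rfl⟩ := Quotient.exists_rep q
        obtain ⟨W, rfl⟩ := Quotient.exists_rep r
        exact fun h h' A hA hU => h' A hA (h A hA hU)
      le_antisymm := by
        intro p q
        obtain ⟨U, rfl⟩ := Quotient.exists_rep p
        obtain ⟨V, rfl⟩ := Quotient.exists_rep q
        exact fun h h' => Quotient.sound ⟨h, h'⟩ }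
  refine ⟨o, fun _ _ => Iff.rfl, (inferInstance : CompactSpace X.UltraQuot), ⟨fun {p q} h => ?_⟩⟩
  obtain ⟨K, hK, hup, hp, hq⟩ := X.exists_isClopen_of_not_ultraLe hX h
  exact ⟨K, hK, fun x y l hx => hup x y l hx, hp, hq⟩

theorem isClosed_ultraLe :
    IsClosed {p : (X.ultraStr hX).carrier × (X.ultraStr hX).carrier |
      (X.ultraStr hX).le p.1 p.2} := by
  rw [← isOpen_compl_iff, isOpen_iff_forall_mem_open]
  rintro ⟨p, q⟩ h
  obtain ⟨K, hK, hup, hp, hq⟩ := X.exists_isClopen_of_not_ultraLe hX h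
  exact ⟨K ×ˢ Kᶜ, fun x hx l => hx.2 (hup _ _ l hx.1), hK.isOpen.prod hK.compl.isOpen, hp, hq⟩

theorem ultraStr_op_mono {f : F} (hf : ∀ x y, X.le x y → X.le (X.op f x) (X.op f y))
    (p q : (X.ultraStr hX).carrier) (h : (X.ultraStr hX).le p q) :
    (X.ultraStr hX).le ((X.ultraStr hX).op f p) ((X.ultraStr hX).op f q) := by
  obtain ⟨U, rfl⟩ := Quotient.exists_rep p
  obtain ⟨V, rfl⟩ := Quotient.exists_rep q
  exact X.ultra_map_mono hf h

theorem ultraStr_op_anti {f : F} (hf : ∀ x y, X.le x y → X.le (X.op f y) (X.op f x))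
    (p q : (X.ultraStr hX).carrier) (h : (X.ultraStr hX).le p q) :
    (X.ultraStr hX).le ((X.ultraStr hX).op f q) ((X.ultraStr hX).op f p) := by
  obtain ⟨U, rfl⟩ := Quotient.exists_rep p
  obtain ⟨V, rfl⟩ := Quotient.exists_rep q
  exact X.ultra_map_anti hf h

/-- Inequalities between terms pass from a structure to its compactification. -/
theorem ultraStr_le_of_le {s t : OTerm F} (h : ∀ w, X.le (s.val X w) (t.val X w))
    (w : ℕ → (X.ultraStr hX).carrier) :
    (X.ultraStr hX).le (s.val (X.ultraStr hX).toOStr w) (t.val (X.ultraStr hX).toOStr w) := by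
  -- Assignments into X are dense among all assignments, and those satisfying the inequality form a
  -- closed set.
  have hd : DenseRange (Pi.map fun _ : ℕ => X.toUltra hX) :=
    DenseRange.piMap fun _ => X.denseRange_toUltra hX
  have hc := (X.isClosed_ultraLe hX).preimage
    ((OTerm.continuous_val _ (X.continuous_ultraStr_op hX) s).prodMk
      (OTerm.continuous_val _ (X.continuous_ultraStr_op hX) t))
  refine hd.induction_on (p := fun w => (X.ultraStr hX).le (s.val (X.ultraStr hX).toOStr w)
    (t.val (X.ultraStr hX).toOStr w)) w hc fun w => ?_
  have hi := X.isHom_toUltra hX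
  have := hi.2 _ _ (h w)
  rwa [OTerm.val_map hi.1, OTerm.val_map hi.1] at this

/-- By antisymmetry of the quotient order, an equation amounts to two inequalities, each of which
holds in X by reflexivity. -/
theorem ultraStr_satisfies (hrefl : ∀ a, X.le a a) {σ : OAtom F} (h : X.Satisfies σ) :
    (X.ultraStr hX).Satisfies σ := by
  cases σ with
  | eq s t =>
    intro w
    obtain ⟨o, ho, -⟩ := X.isPriestley_ultraStr hX
    apply o.le_antisymm <;> rw [ho] <;> apply X.ultraStr_le_of_le hX <;> intro w
    · rw [h w]; exact hrefl _
    · rw [h w]; exact hrefl _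
  | le s t => exact X.ultraStr_le_of_le hX h

/-- A limit of an order-preserving map into a compact space with closed order depends
monotonically on the ultrafilter. -/
theorem extend_mono (Z : TStr.{u, v} F) [CompactSpace Z.carrier] [T2Space Z.carrier]
    (hcl : IsClosed {p : Z.carrier × Z.carrier | Z.le p.1 p.2})
    (hrefl : ∀ a, Z.le a a) (htrans : ∀ a b c, Z.le a b → Z.le b c → Z.le a c)
    {g : X.carrier → Z.carrier} (hg : ∀ a b, X.le a b → Z.le (g a) (g b))
    {U V : Ultrafilter X.carrier} (h : X.ultraPreorder.le U V) :
    Z.le (Ultrafilter.extend g U) (Ultrafilter.extend g V) := by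
  by_contra hn
  obtain ⟨O, O', hO, hO', ha, hb, hOO⟩ := isOpen_prod_iff.1 hcl.isOpen_compl _ _ hn
  have hU : Filter.Tendsto g U (𝓝 (Ultrafilter.extend g U)) := ultrafilter_extend_eq_iff.1 rfl
  have hV : Filter.Tendsto g V (𝓝 (Ultrafilter.extend g V)) := ultrafilter_extend_eq_iff.1 rfl
  -- The up-closure of `O` pulls back to an up-set of X. It lies in `U`, hence in `V`, so it meets
  -- the preimage of `O'`, against the choice of `O × O'`.
  have hUm : g ⁻¹' {z | ∃ x ∈ O, Z.le x z} ∈ U :=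
    Filter.mem_of_superset (hU (hO.mem_nhds ha)) fun x hx => ⟨g x, hx, hrefl _⟩
  have hVm : g ⁻¹' {z | ∃ x ∈ O, Z.le x z} ∈ V :=
    h _ (fun a b l ⟨x, hx, hxa⟩ => ⟨x, hx, htrans _ _ _ hxa (hg a b l)⟩) hUm
  obtain ⟨y, ⟨x, hx, hxy⟩, hy⟩ :=
    V.nonempty_of_mem (Filter.inter_mem hVm (hV (hO'.mem_nhds hb)))
  exact hOO (Set.mk_mem_prod hx hy) hxy

end OStr

/-! ### Extending homomorphisms by density and limits -/

namespace TStr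

/-- A continuous homomorphism between structures with topology. -/
def IsContHom (B Z : TStr.{u, v} F) (h : B.carrier → Z.carrier) : Prop :=
  Continuous h ∧ OStr.IsHom B.toOStr Z.toOStr h

/-- The image of the map is dense in the structure with topology. -/
def HasDenseImage (B : TStr.{u, v} F) {α : Type u} (i : α → B.carrier) : Prop :=
  DenseRange i

theorem IsContHom.comp {A B C : TStr.{u, v} F} {k : B.carrier → C.carrier}
    {h : A.carrier → B.carrier} (hk : IsContHom B C k) (hh : IsContHom A B h) :
    IsContHom A C (k ∘ h) :=
  ⟨hk.1.comp hh.1, hk.2.comp hh.2⟩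

theorem HasDenseImage.eq_of_comp_eq {B Z : TStr.{u, v} F} [T2Space Z.carrier] {α : Type u}
    {i : α → B.carrier} (hi : HasDenseImage B i) {h k : B.carrier → Z.carrier}
    (hh : IsContHom B Z h) (hk : IsContHom B Z k) (e : h ∘ i = k ∘ i) : h = k :=
  DenseRange.equalizer hi hh.1 hk.1 e

/-- To be universal for a class of compact structures it is enough to be dense and to have
extensions. -/
theorem isUniversalCompactification_of_extension {𝒜 : OStr.{u, v} F → Prop}
    {𝒞 : TStr.{u, v} F → Prop} (h𝒞 : ∀ Z, 𝒞 Z → InCt 𝒜 Z) {A : OStr.{u, v} F}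
    {B : TStr.{u, v} F} {i : A.carrier → B.carrier} (hB : 𝒞 B) (hi : OStr.IsEmb A B.toOStr i)
    (hd : HasDenseImage B i)
    (hext : ∀ Z, InCt 𝒜 Z → ∀ g : A.carrier → Z.carrier, OStr.IsHom A Z.toOStr g →
      ∃ h, IsContHom B Z h ∧ h ∘ i = g) :
    IsUniversalCompactification 𝒞 A B i := by
  refine ⟨hB, hi, hd, fun Z hZ g hg => ?_⟩
  obtain ⟨h, hh, he⟩ := hext Z (h𝒞 Z hZ) g hg
  have := (h𝒞 Z hZ).2.1
  exact ⟨h, ⟨hh.1, hh.2, he⟩, fun k ⟨hkc, hkh, hke⟩ =>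
    hd.eq_of_comp_eq ⟨hkc, hkh⟩ hh (hke.trans he.symm)⟩

/-- Two continuous maps that agree on a dense set are equal. The relation cannot be treated this
way: a related pair in `B` need not be a limit of related pairs from `A`. -/
theorem isHom_of_dense {A : OStr.{u, v} F} {B Z : TStr.{u, v} F} [T2Space Z.carrier]
    (hB : ∀ f, Continuous (B.op f)) (hZ : ∀ f, Continuous (Z.op f))
    {i : A.carrier → B.carrier} (hi : OStr.IsHom A B.toOStr i) (hd : DenseRange i)
    {h : B.carrier → Z.carrier} (hc : Continuous h) (hh : OStr.IsHom A Z.toOStr (h ∘ i))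
    (f : F) (b : B.carrier) : h (B.op f b) = Z.op f (h b) := by
  refine congrFun (hd.equalizer (hc.comp (hB f)) ((hZ f).comp hc) (funext fun a => ?_)) b
  have := hh.1 f a
  simp only [Function.comp, hi.1] at this ⊢
  exact this

/-- Homomorphisms into compact structures with a closed order extend to the Priestley
order-compactification. -/
theorem exists_extension_ultraStr (X : OStr.{u, v} F) (hX : X.OpsMonotoneOrAntitone)
    (Z : TStr.{u, v} F) [CompactSpace Z.carrier] [T2Space Z.carrier] (hZ : Z.Compatible)
    (hrefl : ∀ a, Z.le a a) (htrans : ∀ a b c, Z.le a b → Z.le b c → Z.le a c)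
    (hanti : ∀ a b, Z.le a b → Z.le b a → a = b)
    {g : X.carrier → Z.carrier} (hg : OStr.IsHom X Z.toOStr g) :
    ∃ h : (X.ultraStr hX).carrier → Z.carrier,
      IsContHom (X.ultraStr hX) Z h ∧ h ∘ X.toUltra hX = g := by
  have hm {U V : Ultrafilter X.carrier} (l : X.ultraPreorder.le U V) :=
    X.extend_mono Z hZ.2 hrefl htrans hg.2 l
  -- Equivalent ultrafilters have limits below each other, so antisymmetry in `Z` makes the limit
  -- well defined on the quotient.
  let h : (X.ultraStr hX).carrier → Z.carrier :=
    Quotient.lift (Ultrafilter.extend g) fun U V e => hanti _ _ (hm e.1) (hm e.2)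
  have hc : Continuous h := (continuous_ultrafilter_extend g).quotient_lift _
  have he : h ∘ X.toUltra hX = g := ultrafilter_extend_extends g
  refine ⟨h, ⟨hc, isHom_of_dense (X.continuous_ultraStr_op hX) hZ.1 (X.isHom_toUltra hX)
    (X.denseRange_toUltra hX) hc (he.symm ▸ hg), fun p q => ?_⟩, he⟩
  obtain ⟨U, rfl⟩ := Quotient.exists_rep p
  obtain ⟨V, rfl⟩ := Quotient.exists_rep q
  exact hm

/-! ### The natural extension and its extension property -/

section NaturalExtension

variable (M : OStr.{u, v} F) (A : OStr.{u, v} F)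

theorem compatible_pow (I : Type u) : (M.discrete.pow I).Compatible := by
  let _ : TopologicalSpace M.carrier := ⊥
  have : DiscreteTopology M.carrier := ⟨rfl⟩
  refine ⟨fun f => ?_, ?_⟩
  · exact continuous_pi fun i => (continuous_of_discreteTopology (f := M.op f)).comp
      (continuous_apply i)
  · change IsClosed {p : (I → M.carrier) × (I → M.carrier) | ∀ i, M.le (p.1 i) (p.2 i)}
    rw [Set.ofPred_forall]
    exact isClosed_iInter fun i =>
      (isClosed_discrete {q : M.carrier × M.carrier | M.le q.1 q.2}).preimage
        (by fun_prop : Continuous fun p : (I → M.carrier) × (I → M.carrier) => (p.1 i, p.2 i))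

theorem isClosed_closedSpan (Y : TStr.{u, v} F) (E : Set Y.carrier) :
    IsClosed (Y.closedSpan E) :=
  isClosed_sInter fun _ hS => hS.1

/-- If the operations are continuous, the closed substructure generated by a substructure is its
closure. -/
theorem closedSpan_eq_closure (Y : TStr.{u, v} F) (hY : ∀ f, Continuous (Y.op f))
    {E : Set Y.carrier} (hE : Y.toOStr.IsSub E) : Y.closedSpan E = closure E :=
  Set.Subset.antisymm
    (Set.sInter_subset_of_mem ⟨isClosed_closure, fun f _ ha =>
      map_mem_closure (hY f) ha fun x hx => hE f x hx, subset_closure⟩)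
    (closure_minimal (subset_closedSpan Y E) (isClosed_closedSpan Y E))

theorem isSub_range_eval : (M.discrete.pow (OStr.Hom A M)).toOStr.IsSub
    (Set.range (eval M.discrete A)) := by
  rintro f _ ⟨a, rfl⟩
  exact ⟨A.op f a, funext fun x => x.2.1 f a⟩

theorem hasDenseImage_restrict {Y : TStr.{u, v} F} {S : Set Y.carrier} (hS : Y.toOStr.IsSub S)
    {α : Type u} {i : α → (Y.restrict S hS).carrier}
    (h : S ⊆ closure (Set.range fun a => (i a).1)) : HasDenseImage (Y.restrict S hS) i := by
  intro y
  refine closure_subtype.2 ?_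
  rw [← Set.range_comp]
  exact h y.2

theorem hasDenseImage_natEmb : HasDenseImage (natExt M.discrete A) (natEmb M.discrete A) :=
  hasDenseImage_restrict (Y := M.discrete.pow (OStr.Hom A M)) _
    (closedSpan_eq_closure _ (compatible_pow M _).1 (isSub_range_eval M A)).subset

/-- The coordinates of an embedding of `A` into a power of `M` are homomorphisms to `M`, and these
already separate points and detect the relation. -/
theorem isEmb_natEmb (hA : OStr.InISP M A) :
    OStr.IsEmb A (natExt M.discrete A).toOStr (natEmb M.discrete A) := by
  obtain ⟨I, h, hinj, hop, hle⟩ := hA.exists_isEmb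
  let c (i : I) : OStr.Hom A M :=
    ⟨fun a => h a i, fun f a => congrFun (hop f a) i, fun a a' l => (hle a a').1 l i⟩
  refine ⟨fun a a' e => hinj (funext fun i => ?_), fun f a => Subtype.ext (funext fun x => ?_),
    fun a a' => ⟨fun l x => x.2.2 _ _ l, fun l => (hle a a').2 fun i => l (c i)⟩⟩
  · exact congrFun (congrArg Subtype.val e) (c i)
  · exact x.2.1 f a

theorem Compatible.restrict {Y : TStr.{u, v} F} (hY : Y.Compatible) {S : Set Y.carrier}
    (hS : Y.toOStr.IsSub S) : (Y.restrict S hS).Compatible :=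
  ⟨fun f => ((hY.1 f).comp continuous_subtype_val).subtype_mk fun a => hS f a.1 a.2,
    hY.2.preimage (continuous_subtype_val.prodMap continuous_subtype_val)⟩

theorem inBt_natExt [Finite M.carrier] :
    (natExt M.discrete A).InBt (OStr.InISP M) := by
  let _ : TopologicalSpace M.carrier := ⊥
  have : DiscreteTopology M.carrier := ⟨rfl⟩
  let S : Set (OStr.Hom A M → M.carrier) :=
    (M.discrete.pow (OStr.Hom A M)).closedSpan (Set.range (eval M.discrete A))
  have hS : IsClosed S := isClosed_closedSpan _ _
  have : CompactSpace S := isCompact_iff_compactSpace.1 hS.isCompact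
  refine ⟨⟨(inferInstance : CompactSpace S), (inferInstance : T2Space S),
    (compatible_pow M _).restrict _, ?_⟩, ?_⟩
  · exact ⟨OStr.Hom A M, S, closedSpan_isSub (M.discrete.pow (OStr.Hom A M)) _, id,
      Function.surjective_id, Function.injective_id, fun _ _ => rfl, fun _ _ => Iff.rfl⟩
  · exact (isTopologicalBasis_isClopen :
      TopologicalSpace.IsTopologicalBasis {U : Set S | IsClopen U})

/-- Homomorphisms into members of the topological prevariety extend to the natural extension. -/
theorem exists_extension_natExt (B : TStr.{u, v} F) (hB : InIScP M.discrete B)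
    {r : A.carrier → B.carrier} (hr : OStr.IsHom A B.toOStr r) :
    ∃ h : (natExt M.discrete A).carrier → B.carrier,
      IsContHom (natExt M.discrete A) B h ∧ h ∘ natEmb M.discrete A = r := by
  obtain ⟨I, S, hS, k, hcl, hk, hemb⟩ := hB
  let _ : TopologicalSpace M.carrier := ⊥
  let S' : Set (I → M.carrier) := S
  let e : B.carrier ≃ₜ S' := IsHomeomorph.homeomorph (Y := S') k hk
  let c (i : I) : OStr.Hom A M :=
    ⟨fun a => (k (r a)).1 i,
      fun f a => by simp only [hr.1, hemb.2.1],
      fun a a' l => (hemb.2.2 _ _).1 (hr.2 _ _ l) i⟩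
  -- With `B` inside `M ^ I`, each coordinate of `r` indexes a factor of the power containing the
  -- natural extension; `d` projects onto these factors. The preimage of `S` is a closed
  -- substructure containing the evaluations, hence the whole natural extension.
  let d : (OStr.Hom A M → M.carrier) → (I → M.carrier) := fun y i => y (c i)
  have hd : Continuous d := continuous_pi fun i => continuous_apply (c i)
  have hdS : (M.discrete.pow (OStr.Hom A M)).closedSpan (Set.range (eval M.discrete A)) ⊆
      d ⁻¹' S' := by
    refine Set.sInter_subset_of_mem ⟨hcl.preimage hd, fun f y hy => hS f (d y) hy, ?_⟩
    rintro _ ⟨a, rfl⟩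
    exact (k (r a)).2
  have hke (y : S') : k (e.symm y) = y := e.apply_symm_apply y
  refine ⟨fun y => e.symm ⟨d y.1, hdS y.2⟩,
    ⟨e.symm.continuous.comp ((hd.comp continuous_subtype_val).subtype_mk _),
    fun f y => hemb.1 ?_, fun y y' l => (hemb.2.2 _ _).2 ?_⟩, funext fun a => hemb.1 ?_⟩
  · rw [hemb.2.1, hke, hke]
  · rw [hke, hke]
    exact fun i => l (c i)
  · exact hke _

end NaturalExtension

end TStr

end Structures

/-! ### The Bohr compactifications -/

/-- Powers belong to the topological prevariety. -/
theorem TStr.inIScP_pow {F : Type v} (M : TStr.{u, v} F) (I : Type u) :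
    TStr.InIScP M (M.pow I) :=
  ⟨I, Set.univ, fun _ _ _ => trivial, fun x => ⟨x, trivial⟩, isClosed_univ,
    (Homeomorph.Set.univ (I → M.carrier)).symm.isHomeomorph,
    fun _ _ h => congrArg Subtype.val h, fun _ _ => rfl, fun _ _ => Iff.rfl⟩

theorem lemma6p5 {F : Type v} {M : Type u} [Finite M] [PartialOrder M]
    (hM : ¬ IsAntichain (fun a b : M => a ≤ b) Set.univ)
    (φ : F → M → M) (hφ : ∀ f, Monotone (φ f) ∨ Antitone (φ f))
    (Sig : Set (OAtom F))
    (hSig : ∀ X : TStr.{u, v} F, TStr.InIScP (OStr.ofOrder φ).discrete X ↔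
      (X.IsPriestley ∧
        (∀ f,
          (Monotone (φ f) →
            Continuous (X.op f) ∧ ∀ x y, X.le x y → X.le (X.op f x) (X.op f y)) ∧
          (Antitone (φ f) →
            Continuous (X.op f) ∧ ∀ x y, X.le x y → X.le (X.op f y) (X.op f x))) ∧
        ∀ σ ∈ Sig, X.toOStr.Satisfies σ)) :
    ∀ X : OStr.{u, v} F, OStr.InISP (OStr.ofOrder φ) X →
      TStr.IsBohr (OStr.InISP (OStr.ofOrder φ)) X
        (TStr.natExt (OStr.ofOrder φ).discrete X) (TStr.natEmb (OStr.ofOrder φ).discrete X) ∧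
      TStr.IsZeroDimBohr (OStr.InISP (OStr.ofOrder φ)) X
        (TStr.natExt (OStr.ofOrder φ).discrete X) (TStr.natEmb (OStr.ofOrder φ).discrete X) := by

  intro X hX
  obtain ⟨I, j, hj⟩ := hX.exists_isEmb
  have hmono (f : F) (hf : Monotone (φ f)) (x y : X.carrier) (l : X.le x y) :
      X.le (X.op f x) (X.op f y) := by
    rw [hj.2.2, hj.2.1, hj.2.1]
    exact fun i => hf ((hj.2.2 x y).1 l i)
  have hanti (f : F) (hf : Antitone (φ f)) (x y : X.carrier) (l : X.le x y) :
      X.le (X.op f y) (X.op f x) := by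
    rw [hj.2.2, hj.2.1, hj.2.1]
    exact fun i => hf ((hj.2.2 x y).1 l i)
  have hops : X.OpsMonotoneOrAntitone := fun f => (hφ f).imp (hmono f) (hanti f)
  -- The axiomatization is used in both directions: the power `M ^ I` satisfies the axioms,
  -- embeddings pull them back to `X`, and they pass from `X` to `ultraStr`.
  have hB : TStr.InIScP (OStr.ofOrder φ).discrete (X.ultraStr hops) := by
    refine (hSig _).2 ⟨X.isPriestley_ultraStr hops, fun f =>
      ⟨fun hf => ⟨X.continuous_ultraStr_op hops f, X.ultraStr_op_mono hops (hmono f hf)⟩,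
        fun hf => ⟨X.continuous_ultraStr_op hops f, X.ultraStr_op_anti hops (hanti f hf)⟩⟩,
      fun σ hσ => X.ultraStr_satisfies hops (fun a => (hj.2.2 a a).2 fun i => le_refl _)
        (hj.satisfies (((hSig _).1 (TStr.inIScP_pow _ I)).2.2 σ hσ))⟩
  have hBt := TStr.inBt_natExt (OStr.ofOrder φ) X
  have hdense := TStr.hasDenseImage_natEmb (OStr.ofOrder φ) X
  have hemb := TStr.isEmb_natEmb (OStr.ofOrder φ) X hX
  have hext (Z : TStr.{u, v} F) (hZ : Z.InCt (OStr.InISP (OStr.ofOrder φ)))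
      (g : X.carrier → Z.carrier) (hg : OStr.IsHom X Z.toOStr g) :
      ∃ h, TStr.IsContHom (TStr.natExt (OStr.ofOrder φ).discrete X) Z h ∧
        h ∘ TStr.natEmb (OStr.ofOrder φ).discrete X = g := by
    obtain ⟨hcomp, hT2, hcompat, hISP⟩ := hZ
    obtain ⟨J, m, hm⟩ := hISP.exists_isEmb
    -- The extension factors as natural extension → `ultraStr` → `Z`.
    obtain ⟨p, hp, hpe⟩ := TStr.exists_extension_natExt (OStr.ofOrder φ) X _ hB
      (X.isHom_toUltra hops)
    obtain ⟨q, hq, hqe⟩ := TStr.exists_extension_ultraStr X hops Z hcompat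
      (fun a => (hm.2.2 a a).2 fun i => le_refl _)
      (fun a b c l l' => (hm.2.2 a c).2 fun i =>
        le_trans ((hm.2.2 a b).1 l i) ((hm.2.2 b c).1 l' i))
      (fun a b l l' => hm.1 (funext fun i =>
        le_antisymm ((hm.2.2 a b).1 l i) ((hm.2.2 b a).1 l' i))) hg
    exact ⟨q ∘ p, hq.comp hp, by rw [Function.comp_assoc, hpe, hqe]⟩
  exact ⟨TStr.isUniversalCompactification_of_extension (fun _ h => h) hBt.1 hemb hdense hext,
    TStr.isUniversalCompactification_of_extension (fun _ h => h.1) hBt hemb hdense hext⟩
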